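/- Let $n\ge 2$ and let $M$ be a compact smooth manifold with boundary $\Sigma=\partial M$, of dimension $d=n+1$, equipped with a Riemannian metric $g$ that is smooth up to the boundary. Suppose that $(M,g)$ is a Poincaré–Einstein structure, that is, there is a smooth function $x\ge 0$ on $M$ with $\{x=0\}=\Sigma$ and $dx\neq 0$ at every point of $\Sigma$ such that the metric $g_+:=x^{-2}g$ on the interior $M\setminus\Sigma$ satisfies $\operatorname{Ric}(g_+)=-n\,g_+$. Then $\Sigma$ is totally umbilic for the conformal structure $[g]$: for every metric $g'=e^{2u}g$ with $u\in C^\infty(M)$, and at every point of $\Sigma$, the trace-free part of the second fundamental form of $\Sigma$ with respect to $g'$ vanishes, i.e. $I\!I_{ab}=H\,(g'_{ab}-n_an_b)$, where $n_a$ is a unit conormal of $\Sigma$, $I\!I_{ab}=\Pi^c{}_a\Pi^d{}_b\nabla_c n_d$ with $\Pi^c{}_a=\delta^c{}_a-n^cn_a$, $\nabla$ is the Levi-Civita connection of $g'$, and $H=\frac1{d-1}\,g'^{ab}I\!I_{ab}$ is the mean curvature. -/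

import Mathlib

open scoped Manifold ContDiff

noncomputable section

namespace PoincareEinstein

/-! ### Tensor calculus in coordinates

Everything in this section happens in the closed half-space `{y | 0 ≤ y 0}` of `ℝⁿ⁺¹`. A
(pseudo-)metric in coordinates is a matrix-valued function `h`, with entries
`h y i j = h(∂ᵢ, ∂ⱼ)` at `y`. -/

/-- Partial derivative `∂ᵢ f` at the point `y`. The derivative is taken within the closed half-space
`range (𝓡∂ (n + 1)) = {y | 0 ≤ y 0}`, so that it is the usual one where `0 < y 0` and uses
one-sided difference quotients in the direction `0` where `y 0 = 0`. -/
def pderiv {n : ℕ} (i : Fin (n + 1)) (f : EuclideanSpace ℝ (Fin (n + 1)) → ℝ)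
    (y : EuclideanSpace ℝ (Fin (n + 1))) : ℝ :=
  fderivWithin ℝ f (Set.range (𝓡∂ (n + 1))) y (EuclideanSpace.single i 1)

/-- Christoffel symbols of the Levi-Civita connection,
`Γᵏᵢⱼ = ½ ∑ₗ hᵏˡ (∂ᵢ hⱼₗ + ∂ⱼ hᵢₗ - ∂ₗ hᵢⱼ)`. -/
def christoffel {n : ℕ}
    (h : EuclideanSpace ℝ (Fin (n + 1)) → Matrix (Fin (n + 1)) (Fin (n + 1)) ℝ)
    (k i j : Fin (n + 1)) (y : EuclideanSpace ℝ (Fin (n + 1))) : ℝ :=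
  (1 / 2) * ∑ l, (h y)⁻¹ k l *
    (pderiv i (fun z => h z j l) y + pderiv j (fun z => h z i l) y
      - pderiv l (fun z => h z i j) y)

/-- Ricci curvature,
`Ricᵢⱼ = ∑ₖ (∂ₖ Γᵏᵢⱼ - ∂ⱼ Γᵏᵢₖ) + ∑ₖₗ (Γᵏₖₗ Γˡᵢⱼ - Γᵏⱼₗ Γˡᵢₖ)`
(with this sign it is positive on round spheres). -/
def ricci {n : ℕ}
    (h : EuclideanSpace ℝ (Fin (n + 1)) → Matrix (Fin (n + 1)) (Fin (n + 1)) ℝ)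
    (y : EuclideanSpace ℝ (Fin (n + 1))) : Matrix (Fin (n + 1)) (Fin (n + 1)) ℝ :=
  fun i j =>
    ∑ k, (pderiv k (christoffel h k i j) y - pderiv j (christoffel h k i k) y)
    + ∑ k, ∑ l, (christoffel h k k l y * christoffel h l i j y
        - christoffel h k j l y * christoffel h l i k y)

/-- Covariant derivative of a one-form, `(∇ν)ᵢⱼ = ∇ᵢ νⱼ = ∂ᵢ νⱼ - ∑ₖ Γᵏᵢⱼ νₖ`. -/
def covDerivForm {n : ℕ}
    (h : EuclideanSpace ℝ (Fin (n + 1)) → Matrix (Fin (n + 1)) (Fin (n + 1)) ℝ)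
    (ν : EuclideanSpace ℝ (Fin (n + 1)) → Fin (n + 1) → ℝ)
    (y : EuclideanSpace ℝ (Fin (n + 1))) : Matrix (Fin (n + 1)) (Fin (n + 1)) ℝ :=
  fun i j => pderiv i (fun z => ν z j) y - ∑ k, christoffel h k i j y * ν y k

/-- The unit conormal one-form `dy⁰ / |dy⁰|` of the hypersurface `{y 0 = 0}` (and of all the
parallel hypersurfaces `{y 0 = c}`); here `|dy⁰|² = h⁰⁰`. -/
def unitConormal {n : ℕ}
    (h : EuclideanSpace ℝ (Fin (n + 1)) → Matrix (Fin (n + 1)) (Fin (n + 1)) ℝ)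
    (y : EuclideanSpace ℝ (Fin (n + 1))) (j : Fin (n + 1)) : ℝ :=
  if j = 0 then 1 / √((h y)⁻¹ 0 0) else 0

/-- The orthogonal projection `Πᶜₐ = δᶜₐ - nᶜ nₐ` onto the tangent space of the hypersurface,
`n` being its unit conormal and `nᶜ = ∑ₖ hᶜᵏ nₖ`. -/
def tangentialProj {n : ℕ}
    (h : EuclideanSpace ℝ (Fin (n + 1)) → Matrix (Fin (n + 1)) (Fin (n + 1)) ℝ)
    (y : EuclideanSpace ℝ (Fin (n + 1))) : Matrix (Fin (n + 1)) (Fin (n + 1)) ℝ :=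
  fun c a => (if c = a then 1 else 0)
    - (∑ k, (h y)⁻¹ c k * unitConormal h y k) * unitConormal h y a

/-- First fundamental form `hₐᵦ - nₐ nᵦ` of the hypersurface, as a tensor on the ambient space. -/
def firstFundamentalForm {n : ℕ}
    (h : EuclideanSpace ℝ (Fin (n + 1)) → Matrix (Fin (n + 1)) (Fin (n + 1)) ℝ)
    (y : EuclideanSpace ℝ (Fin (n + 1))) : Matrix (Fin (n + 1)) (Fin (n + 1)) ℝ :=
  fun a b => h y a b - unitConormal h y a * unitConormal h y b

/-- Second fundamental form `Πᶜₐ Πᵈᵦ ∇_c n_d` of the hypersurface, as a tensor on the ambient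
space. -/
def secondFundamentalForm {n : ℕ}
    (h : EuclideanSpace ℝ (Fin (n + 1)) → Matrix (Fin (n + 1)) (Fin (n + 1)) ℝ)
    (y : EuclideanSpace ℝ (Fin (n + 1))) : Matrix (Fin (n + 1)) (Fin (n + 1)) ℝ :=
  fun a b => ∑ c, ∑ d, tangentialProj h y c a * tangentialProj h y d b
    * covDerivForm h (unitConormal h) y c d

/-- Mean curvature of the hypersurface (which has dimension `n`): the trace of the second
fundamental form, divided by `n`. -/
def meanCurvature {n : ℕ}
    (h : EuclideanSpace ℝ (Fin (n + 1)) → Matrix (Fin (n + 1)) (Fin (n + 1)) ℝ)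
    (y : EuclideanSpace ℝ (Fin (n + 1))) : ℝ :=
  (1 / (n : ℝ)) * ∑ a, ∑ b, (h y)⁻¹ a b * secondFundamentalForm h y a b

/-! ### Manifolds with boundary -/

section Manifold

variable {n : ℕ} {M : Type*} [TopologicalSpace M]
  [ChartedSpace (EuclideanHalfSpace (n + 1)) M]

/-- Smooth Riemannian metrics (positive definite, smooth up to the boundary) on an
`(n + 1)`-dimensional smooth manifold with boundary. -/
abbrev SmoothMetric (n : ℕ) (M : Type*) [TopologicalSpace M]
    [ChartedSpace (EuclideanHalfSpace (n + 1)) M] [IsManifold (𝓡∂ (n + 1)) ∞ M] :=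
  Bundle.ContMDiffRiemannianMetric (𝓡∂ (n + 1)) ∞ (EuclideanSpace ℝ (Fin (n + 1)))
    (fun p : M => TangentSpace (𝓡∂ (n + 1)) p)

/-- The coordinate vector field `∂ᵢ` of the chart `e`, at the point with coordinates `y`. -/
def coordVector (e : OpenPartialHomeomorph M (EuclideanHalfSpace (n + 1))) (i : Fin (n + 1))
    (y : EuclideanSpace ℝ (Fin (n + 1))) :
    TangentSpace (𝓡∂ (n + 1)) ((e.extend (𝓡∂ (n + 1))).symm y) :=
  mfderivWithin 𝓘(ℝ, EuclideanSpace ℝ (Fin (n + 1))) (𝓡∂ (n + 1))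
    (e.extend (𝓡∂ (n + 1))).symm (Set.range (𝓡∂ (n + 1))) y
    (EuclideanSpace.single i (1 : ℝ) : EuclideanSpace ℝ (Fin (n + 1)))

/-- The components `b(∂ᵢ, ∂ⱼ)` in the chart `e` of a field `b` of bilinear forms on `M`, as
functions of the coordinates. -/
def coordMatrix (b : ∀ p : M, TangentSpace (𝓡∂ (n + 1)) p →L[ℝ]
      TangentSpace (𝓡∂ (n + 1)) p →L[ℝ] ℝ)
    (e : OpenPartialHomeomorph M (EuclideanHalfSpace (n + 1)))
    (y : EuclideanSpace ℝ (Fin (n + 1))) : Matrix (Fin (n + 1)) (Fin (n + 1)) ℝ :=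
  fun i j => b ((e.extend (𝓡∂ (n + 1))).symm y) (coordVector e i y) (coordVector e j y)

/-- `x` is a (smooth, non-negative) defining function for the boundary `∂M`: the zero set of `x` is
`∂M`, and `dx` vanishes nowhere on `∂M`. -/
structure IsDefiningFunction (n : ℕ) {M : Type*} [TopologicalSpace M]
    [ChartedSpace (EuclideanHalfSpace (n + 1)) M] (x : M → ℝ) : Prop where
  smooth : ContMDiff (𝓡∂ (n + 1)) 𝓘(ℝ) ∞ x
  nonneg : ∀ p, 0 ≤ x p
  eq_zero_iff : ∀ p, x p = 0 ↔ p ∈ (𝓡∂ (n + 1)).boundary M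
  mfderiv_ne_zero : ∀ p ∈ (𝓡∂ (n + 1)).boundary M, mfderiv (𝓡∂ (n + 1)) 𝓘(ℝ) x p ≠ 0

/-- The field of bilinear forms `b` is, on the interior of `M`, an Einstein metric with
`Ric = -n b`: this tensor equation holds at every interior point in every chart of `M` around
it. -/
def IsInteriorEinstein (b : ∀ p : M, TangentSpace (𝓡∂ (n + 1)) p →L[ℝ]
      TangentSpace (𝓡∂ (n + 1)) p →L[ℝ] ℝ) : Prop :=
  ∀ e ∈ atlas (EuclideanHalfSpace (n + 1)) M, ∀ p ∈ e.source,
    p ∈ (𝓡∂ (n + 1)).interior M →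
      ricci (coordMatrix b e) (e.extend (𝓡∂ (n + 1)) p)
        = (-(n : ℝ)) • coordMatrix b e (e.extend (𝓡∂ (n + 1)) p)

variable [IsManifold (𝓡∂ (n + 1)) ∞ M]

/-- `(M, g)` is a Poincaré–Einstein structure: there is a defining function `x` for the boundary
such that the metric `g₊ = x⁻² g` on the interior satisfies `Ric(g₊) = -n g₊`, where
`dim M = n + 1`. (The values of `g₊` on the boundary play no role.) -/
def IsPoincareEinstein (g : SmoothMetric n M) : Prop :=
  ∃ x : M → ℝ, IsDefiningFunction n x ∧
    IsInteriorEinstein (fun p : M => ((x p) ^ 2)⁻¹ • g.inner p)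

/-- `g'` belongs to the conformal class `[g]`: `g' = exp(2u) g` for a smooth function `u`. -/
def IsConformal (g g' : SmoothMetric n M) : Prop :=
  ∃ u : M → ℝ, ContMDiff (𝓡∂ (n + 1)) 𝓘(ℝ) ∞ u ∧
    ∀ p : M, g'.inner p = Real.exp (2 * u p) • g.inner p

/-- The boundary `∂M` is totally umbilic with respect to `g`: at every boundary point the
trace-free part of its second fundamental form vanishes, i.e. the second fundamental form equals the
mean curvature times the first fundamental form, in every chart of `M` around the point. (In a
chart, the boundary is the hypersurface `{y 0 = 0}`.) -/
def IsBoundaryTotallyUmbilic (g : SmoothMetric n M) : Prop :=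
  ∀ e ∈ atlas (EuclideanHalfSpace (n + 1)) M, ∀ p ∈ e.source,
    p ∈ (𝓡∂ (n + 1)).boundary M →
      secondFundamentalForm (coordMatrix g.inner e) (e.extend (𝓡∂ (n + 1)) p)
        = meanCurvature (coordMatrix g.inner e) (e.extend (𝓡∂ (n + 1)) p) •
          firstFundamentalForm (coordMatrix g.inner e) (e.extend (𝓡∂ (n + 1)) p)

end Manifold

end PoincareEinstein

end

/-! In a boundary chart write `h` for the metric, `X` for the defining function and `y 0` for the
coordinate vanishing on the boundary. In dimension `n + 1`, conformal change gives, modulo multiples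
of `h`, `Ric(X⁻² h) = Ric(h) + (n - 1) X⁻¹ ∇²X` (`ricci_conformal`). If `X⁻² h` is Einstein, then `X
Ric(h) + (n - 1) ∇²X` is a multiple of `h` in the interior. This tensor is smooth up to the
boundary, so it is still a multiple of `h` where `X = 0`. There only `(n - 1) ∇²X` is left, and `n ≥
2` makes `∇²X` pure trace.

It remains to compare `∇²X` with the second fundamental form (`umbilic_of_hessian`). Along the
boundary `dX = ∂₀X dy⁰` with `∂₀X ≠ 0`. In tangential directions second partials of `X` vanish, so
`∇²X` is `-Γ⁰ᵢⱼ ∂₀X`, while `∇n` is `-Γ⁰ᵢⱼ n₀`. The two are proportional, so the second fundamental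
form is a multiple of the first, and the trace identifies the factor as `H`.

The statement for all of `[g]` follows because the hypothesis is conformally invariant: `x⁻² g = (eᵘ
x)⁻² (e²ᵘ g)`. -/

namespace PoincareEinstein

/-! ### Partial derivatives in the half-space, up to the boundary. -/

section Calculus

variable {n : ℕ} {f f' : EuclideanSpace ℝ (Fin (n + 1)) → ℝ}
  {y : EuclideanSpace ℝ (Fin (n + 1))}

theorem pderiv_congr (i : Fin (n + 1)) (hy : y ∈ Set.range (𝓡∂ (n + 1)))
    (h : f =ᶠ[nhdsWithin y (Set.range (𝓡∂ (n + 1)))] f') : pderiv i f y = pderiv i f' y := by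
  unfold pderiv
  rw [h.fderivWithin_eq (h.self_of_nhdsWithin hy)]

theorem pderiv_add (i : Fin (n + 1)) (hy : y ∈ Set.range (𝓡∂ (n + 1)))
    (hf : DifferentiableWithinAt ℝ f (Set.range (𝓡∂ (n + 1))) y)
    (hf' : DifferentiableWithinAt ℝ f' (Set.range (𝓡∂ (n + 1))) y) :
    pderiv i (fun z => f z + f' z) y = pderiv i f y + pderiv i f' y := by
  unfold pderiv
  rw [fderivWithin_fun_add ((𝓡∂ (n + 1)).uniqueDiffOn y hy) hf hf']
  rfl

theorem pderiv_sub (i : Fin (n + 1)) (hy : y ∈ Set.range (𝓡∂ (n + 1)))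
    (hf : DifferentiableWithinAt ℝ f (Set.range (𝓡∂ (n + 1))) y)
    (hf' : DifferentiableWithinAt ℝ f' (Set.range (𝓡∂ (n + 1))) y) :
    pderiv i (fun z => f z - f' z) y = pderiv i f y - pderiv i f' y := by
  unfold pderiv
  rw [fderivWithin_fun_sub ((𝓡∂ (n + 1)).uniqueDiffOn y hy) hf hf']
  rfl

theorem pderiv_mul (i : Fin (n + 1)) (hy : y ∈ Set.range (𝓡∂ (n + 1)))
    (hf : DifferentiableWithinAt ℝ f (Set.range (𝓡∂ (n + 1))) y)
    (hf' : DifferentiableWithinAt ℝ f' (Set.range (𝓡∂ (n + 1))) y) :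
    pderiv i (fun z => f z * f' z) y = pderiv i f y * f' y + f y * pderiv i f' y := by
  unfold pderiv
  rw [fderivWithin_fun_mul ((𝓡∂ (n + 1)).uniqueDiffOn y hy) hf hf']
  simp
  ring

theorem pderiv_const (i : Fin (n + 1)) (c : ℝ) :
    pderiv i (fun _ => c) y = 0 := by
  unfold pderiv
  simp

theorem pderiv_mul_const (i : Fin (n + 1)) (hy : y ∈ Set.range (𝓡∂ (n + 1)))
    (hf : DifferentiableWithinAt ℝ f (Set.range (𝓡∂ (n + 1))) y) (c : ℝ) :
    pderiv i (fun z => f z * c) y = pderiv i f y * c := by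
  rw [pderiv_mul i hy hf (differentiableWithinAt_const c), pderiv_const]
  ring

theorem pderiv_sum {ι : Type*} (s : Finset ι) (F : ι → EuclideanSpace ℝ (Fin (n + 1)) → ℝ)
    (i : Fin (n + 1)) (hy : y ∈ Set.range (𝓡∂ (n + 1)))
    (hF : ∀ k ∈ s, DifferentiableWithinAt ℝ (F k) (Set.range (𝓡∂ (n + 1))) y) :
    pderiv i (fun z => ∑ k ∈ s, F k z) y = ∑ k ∈ s, pderiv i (F k) y := by
  unfold pderiv
  rw [fderivWithin_fun_sum ((𝓡∂ (n + 1)).uniqueDiffOn y hy) hF]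
  simp

theorem pderiv_inv (i : Fin (n + 1)) (hy : y ∈ Set.range (𝓡∂ (n + 1)))
    (hf : DifferentiableWithinAt ℝ f (Set.range (𝓡∂ (n + 1))) y) (h0 : f y ≠ 0) :
    pderiv i (fun z => (f z)⁻¹) y = -(pderiv i f y) / f y ^ 2 := by
  have h1 : pderiv i (fun z => f z * (f z)⁻¹) y = 0 := by
    rw [pderiv_congr (f' := fun _ => 1) i hy, pderiv_const]
    filter_upwards [hf.continuousWithinAt.eventually_ne h0] with z hz
    exact mul_inv_cancel₀ hz
  rw [pderiv_mul (f' := fun z => (f z)⁻¹) i hy hf (hf.inv h0)] at h1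
  field_simp at h1 ⊢
  linarith

theorem contDiffWithinAt_pderiv (i : Fin (n + 1)) (hy : y ∈ Set.range (𝓡∂ (n + 1)))
    (hf : ContDiffWithinAt ℝ ∞ f (Set.range (𝓡∂ (n + 1))) y) :
    ContDiffWithinAt ℝ ∞ (pderiv i f) (Set.range (𝓡∂ (n + 1))) y :=
  (hf.fderivWithin_right (m := ∞) (𝓡∂ (n + 1)).uniqueDiffOn (by simp) hy).clm_apply
    contDiffWithinAt_const

/-- Symmetry of second derivatives persists at boundary points because the half-space lies in the
closure of its interior. -/
theorem pderiv_comm (i j : Fin (n + 1)) (hy : y ∈ Set.range (𝓡∂ (n + 1)))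
    (hf : ContDiffWithinAt ℝ ∞ f (Set.range (𝓡∂ (n + 1))) y) :
    pderiv i (pderiv j f) y = pderiv j (pderiv i f) y := by
  have hS : UniqueDiffOn ℝ (Set.range (𝓡∂ (n + 1))) := (𝓡∂ (n + 1)).uniqueDiffOn
  have hd : DifferentiableWithinAt ℝ (fderivWithin ℝ f (Set.range (𝓡∂ (n + 1))))
      (Set.range (𝓡∂ (n + 1))) y :=
    (hf.fderivWithin_right (m := ∞) hS (by simp) hy).differentiableWithinAt (by simp)
  have key : ∀ v w : EuclideanSpace ℝ (Fin (n + 1)),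
      fderivWithin ℝ (fun z => fderivWithin ℝ f (Set.range (𝓡∂ (n + 1))) z v)
        (Set.range (𝓡∂ (n + 1))) y w
        = fderivWithin ℝ (fderivWithin ℝ f (Set.range (𝓡∂ (n + 1))))
          (Set.range (𝓡∂ (n + 1))) y w v := by
    intro v w
    rw [fderivWithin_clm_apply (hS y hy) hd (differentiableWithinAt_const v)]
    simp
  unfold pderiv
  rw [key, key]
  refine (ContDiffWithinAt.isSymmSndFDerivWithinAt hf
    (by simpa using WithTop.coe_le_coe.2 (le_top : (2 : ℕ∞) ≤ ⊤)) hS ?_ hy) _ _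
  exact (𝓡∂ (n + 1)).range_subset_closure_interior hy

/-- A function that vanishes on the boundary of the half-space has vanishing tangential
derivatives there. -/
theorem pderiv_eq_zero_of_vanish {i : Fin (n + 1)} (hi : i ≠ 0)
    (hy0 : y 0 = 0)
    (hf : DifferentiableWithinAt ℝ f (Set.range (𝓡∂ (n + 1))) y)
    (h0 : ∀ᶠ z in nhdsWithin y (Set.range (𝓡∂ (n + 1))), z 0 = 0 → f z = 0) :
    pderiv i f y = 0 := by
  set e : EuclideanSpace ℝ (Fin (n + 1)) := EuclideanSpace.single i (1 : ℝ)
  -- For `i ≠ 0` the line through `y` in direction `i` stays in the boundary hyperplane, so `f`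
  -- restricted to it has an ordinary two-sided derivative, and this restriction vanishes near `t =
  -- 0`.
  have hline : HasDerivAt (fun t : ℝ => y + t • e) e 0 := by
    simpa using ((hasDerivAt_id (0 : ℝ)).smul_const e).const_add y
  have hz : ∀ t : ℝ, (y + t • e) 0 = 0 := by
    intro t
    simp [e, hy0, hi.symm]
  have hmem : ∀ t : ℝ, y + t • e ∈ Set.range (𝓡∂ (n + 1)) := by
    intro t
    rw [range_modelWithCornersEuclideanHalfSpace]
    exact (hz t).ge
  have hlim : Filter.Tendsto (fun t : ℝ => y + t • e) (nhds 0)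
      (nhdsWithin y (Set.range (𝓡∂ (n + 1)))) := by
    refine tendsto_nhdsWithin_iff.2 ⟨?_, Filter.Eventually.of_forall hmem⟩
    simpa using hline.continuousAt.tendsto
  have hD : HasDerivAt (fun t : ℝ => f (y + t • e)) (pderiv i f y) 0 := by
    have h := hf.hasFDerivWithinAt
    rw [show y = y + (0 : ℝ) • e by simp] at h
    have := HasFDerivWithinAt.comp_hasDerivWithinAt (s := Set.univ) (0 : ℝ) h
      hline.hasDerivWithinAt (fun t _ => hmem t)
    simp only [zero_smul, add_zero] at this
    exact this.hasDerivAt Filter.univ_mem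
  have hE : (fun t : ℝ => f (y + t • e)) =ᶠ[nhds 0] fun _ => 0 := by
    filter_upwards [hlim.eventually h0] with t ht using ht (hz t)
  exact (hD.congr_of_eventuallyEq hE.symm).unique (hasDerivAt_const _ _)

end Calculus

end PoincareEinstein

namespace PoincareEinstein

/-! ### Pointwise index algebra for the conformal change of Ricci curvature. -/

section Algebra

variable {n : ℕ}

/-- The quadratic part of the Ricci tensor of the connection `Γ + a ⊗ δ + δ ⊗ a - h ⊗ V`, compared
with that of `Γ`. Here `a = h V`. -/
theorem ricci_quadratic_conformal (G G' : Fin (n + 1) → Fin (n + 1) → Fin (n + 1) → ℝ)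
    (H : Fin (n + 1) → Fin (n + 1) → ℝ) (a V : Fin (n + 1) → ℝ)
    (hG : ∀ k i j, G k i j = G k j i) (hH : ∀ i j, H i j = H j i)
    (haV : ∀ i, ∑ k, H i k * V k = a i)
    (hG' : ∀ k i j, G' k i j
      = G k i j + (if k = j then a i else 0) + (if k = i then a j else 0) - H i j * V k)
    (i j : Fin (n + 1)) :
    ∑ k, ∑ l, (G' k k l * G' l i j - G' k j l * G' l i k)
      = ∑ k, ∑ l, (G k k l * G l i j - G k j l * G l i k)
        + ((n : ℝ) - 1) * (∑ l, a l * G l i j + a i * a j)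
        + ∑ k, ∑ l, (G l k i * H l j + G l k j * H i l) * V k
        - H i j * (∑ l, (∑ k, G k k l) * V l + ((n : ℝ) - 1) * ∑ l, a l * V l) := by
  -- The two `δ` terms contract to `(n + 1) a + a`, and the term in `V` removes one `a` because `H V
  -- = a`.
  have hT : ∀ l, ∑ k, G' k k l = ∑ k, G k k l + ((n : ℝ) + 1) * a l := by
    intro l
    simp only [hG', Finset.sum_add_distrib, Finset.sum_sub_distrib, Finset.sum_ite_eq',
      Finset.mem_univ, if_true, Finset.sum_const, Finset.card_univ, Fintype.card_fin]
    simp only [fun k => hH k l, haV]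
    simp only [nsmul_eq_mul]
    push_cast
    ring
  have hT' : ∀ l, ∑ k, G' k l k = ∑ k, G k k l + ((n : ℝ) + 1) * a l := by
    intro l
    rw [← hT]
    refine Finset.sum_congr rfl fun k _ => ?_
    rw [hG', hG', hG k l k, hH l k]
    ring
  have hN : ∀ c : ℝ, ∑ l, a l * (c * V l) = c * ∑ l, a l * V l := by
    intro c
    rw [Finset.mul_sum]
    exact Finset.sum_congr rfl fun l _ => by ring
  have h1 : ∑ k, ∑ l, G' k k l * G' l i j
      = ∑ k, ∑ l, G k k l * G l i j + ((n : ℝ) + 1) * ∑ l, a l * G l i j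
        + (∑ k, G k k j + ((n : ℝ) + 1) * a j) * a i
        + (∑ k, G k k i + ((n : ℝ) + 1) * a i) * a j
        - H i j * (∑ l, (∑ k, G k k l) * V l + ((n : ℝ) + 1) * ∑ l, a l * V l) := by
    -- Summing over `k` first exposes the contracted symbol, so that `hT` applies.
    rw [Finset.sum_comm, Finset.sum_comm (f := fun k l => G k k l * G l i j)]
    simp only [← Finset.sum_mul, hT]
    simp only [hG', mul_add, mul_sub, Finset.sum_add_distrib, Finset.sum_sub_distrib, mul_ite,
      mul_zero, Finset.sum_ite_eq', Finset.mem_univ, if_true, add_mul, Finset.mul_sum]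
    have e1 : ∀ c : ℝ, ∑ l, (∑ k, G k k l) * (c * V l) = ∑ l, c * ((∑ k, G k k l) * V l) :=
      fun c => Finset.sum_congr rfl fun l _ => by ring
    simp only [e1, mul_assoc]
    ring_nf
  have hA : ∑ l, a l * G' l i j = ∑ l, a l * G l i j + 2 * (a i * a j)
      - H i j * ∑ l, a l * V l := by
    simp only [hG', mul_add, mul_sub, Finset.sum_add_distrib, Finset.sum_sub_distrib, mul_ite,
      mul_zero, Finset.sum_ite_eq', Finset.mem_univ, if_true, hN]
    ring
  have hB : ∑ k, ∑ l, G k j l * G' l i k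
      = ∑ k, ∑ l, G k j l * G l i k + a i * ∑ k, G k k j + ∑ l, a l * G l i j
        - ∑ k, ∑ l, G l k j * H i l * V k := by
    have e1 : ∀ k, ∑ l, G k j l * G' l i k = ∑ l, G k j l * G l i k + G k j k * a i
        + G k j i * a k - ∑ l, G k j l * H i k * V l := by
      intro k
      simp only [hG', mul_add, mul_sub, Finset.sum_add_distrib, Finset.sum_sub_distrib, mul_ite,
        mul_zero, Finset.sum_ite_eq', Finset.mem_univ, if_true, mul_assoc]
    simp only [e1, Finset.sum_add_distrib, Finset.sum_sub_distrib]
    have e2 : ∑ k, G k j i * a k = ∑ l, a l * G l i j :=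
      Finset.sum_congr rfl fun k _ => by rw [hG k j i]; ring
    have e3 : ∑ k, G k j k * a i = a i * ∑ k, G k k j := by
      rw [Finset.mul_sum]
      exact Finset.sum_congr rfl fun k _ => by rw [hG k j k]; ring
    have e4 : ∑ k, ∑ l, G k j l * H i k * V l = ∑ k, ∑ l, G l k j * H i l * V k := by
      rw [Finset.sum_comm]
      exact Finset.sum_congr rfl fun k _ => Finset.sum_congr rfl fun l _ => by rw [hG l j k]
    rw [e2, e3, e4]
  have hC : ∑ k, ∑ l, H j l * V k * G' l i k
      = ∑ k, ∑ l, G l k i * H l j * V k + H i j * ∑ l, a l * V l := by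
    have e1 : ∀ k, ∑ l, H j l * V k * G' l i k
        = ∑ l, G l k i * H l j * V k + H j k * V k * a i + H i j * (a k * V k)
          - a j * (H i k * V k) := by
      intro k
      have e2 : ∑ l, H j l * V k * (H i k * V l) = a j * (H i k * V k) := by
        rw [← haV j, Finset.sum_mul]
        exact Finset.sum_congr rfl fun l _ => by ring
      have e3 : ∑ l, H j l * V k * G l i k = ∑ l, G l k i * H l j * V k :=
        Finset.sum_congr rfl fun l _ => by rw [hG l i k, hH j l]; ring
      simp only [hG', mul_add, mul_sub, Finset.sum_add_distrib, Finset.sum_sub_distrib, mul_ite,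
        mul_zero, Finset.sum_ite_eq', Finset.mem_univ, if_true, e2, e3]
      rw [hH j i]
      ring
    simp only [e1, Finset.sum_add_distrib, Finset.sum_sub_distrib, ← Finset.mul_sum,
      ← Finset.sum_mul, haV]
    ring
  -- Only the first factor is expanded here; the four resulting pieces are evaluated by `hB`, `hT'`,
  -- `hA` and `hC`.
  have h2 : ∑ k, ∑ l, G' k j l * G' l i k
      = ∑ k, ∑ l, G k j l * G' l i k + a j * ∑ k, G' k i k + ∑ l, a l * G' l i j
        - ∑ k, ∑ l, H j l * V k * G' l i k := by
    have e1 : ∀ k, ∑ l, G' k j l * G' l i k = ∑ l, G k j l * G' l i k + a j * G' k i k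
        + (if k = j then ∑ l, a l * G' l i k else 0) - ∑ l, H j l * V k * G' l i k := by
      intro k
      have e2 : ∀ l, G' k j l * G' l i k = G k j l * G' l i k
          + (if k = l then a j * G' l i k else 0)
          + (if k = j then a l * G' l i k else 0) - H j l * V k * G' l i k := by
        intro l
        rw [hG' k j l]
        split_ifs <;> ring
      simp only [e2, Finset.sum_add_distrib, Finset.sum_sub_distrib, Finset.sum_ite_eq,
        Finset.mem_univ, if_true]
      congr 2
      split_ifs <;> simp
    simp only [e1, Finset.sum_add_distrib, Finset.sum_sub_distrib, Finset.sum_ite_eq',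
      Finset.mem_univ, if_true, ← Finset.mul_sum]
  have hD : ∑ k, ∑ l, (G l k i * H l j + G l k j * H i l) * V k
      = ∑ k, ∑ l, G l k i * H l j * V k + ∑ k, ∑ l, G l k j * H i l * V k := by
    simp only [add_mul, Finset.sum_add_distrib]
  simp only [Finset.sum_sub_distrib]
  rw [h1, h2, hA, hB, hC, hD, hT']
  ring

/-- The divergence of `a ⊗ δ + δ ⊗ a - H ⊗ V` in its upper index, at a point: `da`, `dH`, `dV` stand
for the first derivatives of `a`, `H`, `V`. -/
theorem ricci_linear_conformal (dH : Fin (n + 1) → Fin (n + 1) → Fin (n + 1) → ℝ)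
    (H : Fin (n + 1) → Fin (n + 1) → ℝ)
    (da dV : Fin (n + 1) → Fin (n + 1) → ℝ) (V : Fin (n + 1) → ℝ)
    (i j : Fin (n + 1)) :
    ∑ k, ((if k = j then da k i else 0) + (if k = i then da k j else 0)
        - (dH k i j * V k + H i j * dV k k))
      = da j i + da i j - ∑ k, dH k i j * V k - H i j * ∑ k, dV k k := by
  simp only [Finset.sum_add_distrib, Finset.sum_sub_distrib, Finset.sum_ite_eq', Finset.mem_univ,
    if_true, ← Finset.mul_sum]
  ring

end Algebra

end PoincareEinstein

namespace PoincareEinstein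

/-! ### Levi-Civita connection and Ricci curvature of `X⁻² h`. -/

section Conformal

variable {n : ℕ} {h : EuclideanSpace ℝ (Fin (n + 1)) → Matrix (Fin (n + 1)) (Fin (n + 1)) ℝ}
  {X : EuclideanSpace ℝ (Fin (n + 1)) → ℝ} {y : EuclideanSpace ℝ (Fin (n + 1))}

/-- The entries of `h` are smooth at `y`, within the half-space. -/
def SmoothMatrixAt (h : EuclideanSpace ℝ (Fin (n + 1)) → Matrix (Fin (n + 1)) (Fin (n + 1)) ℝ)
    (y : EuclideanSpace ℝ (Fin (n + 1))) : Prop :=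
  ∀ i j, ContDiffWithinAt ℝ ∞ (fun z => h z i j) (Set.range (𝓡∂ (n + 1))) y

theorem contDiffWithinAt_det {m : ℕ} {s : Set (EuclideanSpace ℝ (Fin (n + 1)))}
    {F : EuclideanSpace ℝ (Fin (n + 1)) → Matrix (Fin m) (Fin m) ℝ}
    (hF : ∀ i j, ContDiffWithinAt ℝ ∞ (fun z => F z i j) s y) :
    ContDiffWithinAt ℝ ∞ (fun z => (F z).det) s y := by
  simp only [Matrix.det_apply']
  exact ContDiffWithinAt.sum fun σ _ =>
    contDiffWithinAt_const.mul (contDiffWithinAt_prod fun i _ => hF _ _)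

theorem SmoothMatrixAt.inv (hh : SmoothMatrixAt h y) (hdet : (h y).det ≠ 0) :
    SmoothMatrixAt (fun z => (h z)⁻¹) y := by
  intro i j
  have hd : ContDiffWithinAt ℝ ∞ (fun z => ((h z).det)⁻¹) (Set.range (𝓡∂ (n + 1))) y :=
    (contDiffWithinAt_det hh).inv hdet
  have ha : ContDiffWithinAt ℝ ∞ (fun z => (h z).adjugate i j) (Set.range (𝓡∂ (n + 1))) y := by
    simp only [Matrix.adjugate_apply]
    refine contDiffWithinAt_det fun a b => ?_
    by_cases hab : a = j
    · subst hab
      simpa using contDiffWithinAt_const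
    · simpa [Matrix.updateRow_apply, hab] using hh a b
  simpa [Matrix.inv_def] using hd.mul ha

theorem SmoothMatrixAt.christoffel (hy : y ∈ Set.range (𝓡∂ (n + 1)))
    (hh : SmoothMatrixAt h y) (hdet : (h y).det ≠ 0) (k i j : Fin (n + 1)) :
    ContDiffWithinAt ℝ ∞ (christoffel h k i j) (Set.range (𝓡∂ (n + 1))) y := by
  have hi := hh.inv hdet
  refine contDiffWithinAt_const.mul (ContDiffWithinAt.sum fun l _ => (hi k l).mul ?_)
  exact ((contDiffWithinAt_pderiv _ hy (hh _ _)).add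
    (contDiffWithinAt_pderiv _ hy (hh _ _))).sub (contDiffWithinAt_pderiv _ hy (hh _ _))

/-- Together with `contDiffWithinAt_hessian`, this is what allows the Einstein equation, cleared of
denominators, to be carried to the boundary by continuity. -/
theorem contDiffWithinAt_ricci (hy : y ∈ Set.range (𝓡∂ (n + 1)))
    (hh : SmoothMatrixAt h y) (hdet : (h y).det ≠ 0) :
    SmoothMatrixAt (ricci h) y := by
  intro i j
  have hc := hh.christoffel hy hdet
  refine (ContDiffWithinAt.sum fun k _ => ?_).add
    (ContDiffWithinAt.sum fun k _ => ContDiffWithinAt.sum fun l _ => ?_)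
  · exact (contDiffWithinAt_pderiv _ hy (hc _ _ _)).sub (contDiffWithinAt_pderiv _ hy (hc _ _ _))
  · exact ((hc _ _ _).mul (hc _ _ _)).sub ((hc _ _ _).mul (hc _ _ _))

theorem contDiffWithinAt_hessian (hy : y ∈ Set.range (𝓡∂ (n + 1)))
    (hh : SmoothMatrixAt h y) (hdet : (h y).det ≠ 0)
    (hX : ContDiffWithinAt ℝ ∞ X (Set.range (𝓡∂ (n + 1))) y) :
    SmoothMatrixAt (covDerivForm h fun z j => pderiv j X z) y := by
  intro i j
  have hc := hh.christoffel hy hdet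
  exact (contDiffWithinAt_pderiv _ hy (contDiffWithinAt_pderiv _ hy hX)).sub
    (ContDiffWithinAt.sum fun k _ => (hc _ _ _).mul (contDiffWithinAt_pderiv _ hy hX))

theorem sum_mul_inv_mul {A : Matrix (Fin (n + 1)) (Fin (n + 1)) ℝ} (hA : A.det ≠ 0)
    (c : Fin (n + 1) → ℝ) (i : Fin (n + 1)) : ∑ m, A i m * ∑ l, A⁻¹ m l * c l = c i := by
  have := congrFun (congrArg (fun B => B.mulVec c)
    (Matrix.mul_nonsing_inv A (isUnit_iff_ne_zero.2 hA))) i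
  rw [← Matrix.mulVec_mulVec, Matrix.one_mulVec] at this
  exact this

theorem sum_inv_mul_mul {A : Matrix (Fin (n + 1)) (Fin (n + 1)) ℝ} (hA : A.det ≠ 0)
    (i j : Fin (n + 1)) : ∑ l, A⁻¹ i l * A l j = if i = j then 1 else 0 := by
  have := congrFun (congrFun (Matrix.nonsing_inv_mul A (isUnit_iff_ne_zero.2 hA)) i) j
  rwa [Matrix.one_apply] at this

theorem pderiv_symm (hy : y ∈ Set.range (𝓡∂ (n + 1)))
    (hs : ∀ᶠ z in nhdsWithin y (Set.range (𝓡∂ (n + 1))), (h z).IsSymm) (l i j : Fin (n + 1)) :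
    pderiv l (fun z => h z i j) y = pderiv l (fun z => h z j i) y := by
  refine pderiv_congr l hy ?_
  filter_upwards [hs] with z hz using hz.apply j i

theorem christoffel_symm (hy : y ∈ Set.range (𝓡∂ (n + 1)))
    (hs : ∀ᶠ z in nhdsWithin y (Set.range (𝓡∂ (n + 1))), (h z).IsSymm) (k i j : Fin (n + 1)) :
    christoffel h k i j y = christoffel h k j i y := by
  unfold christoffel
  congr 1
  refine Finset.sum_congr rfl fun l _ => ?_
  rw [pderiv_symm hy hs l i j]
  ring

/-- The Levi-Civita connection is compatible with the metric. -/
theorem pderiv_metric (hy : y ∈ Set.range (𝓡∂ (n + 1)))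
    (hs : ∀ᶠ z in nhdsWithin y (Set.range (𝓡∂ (n + 1))), (h z).IsSymm)
    (hdet : (h y).det ≠ 0) (k i j : Fin (n + 1)) :
    pderiv k (fun z => h z i j) y
      = ∑ l, (christoffel h l k i y * h y l j + christoffel h l k j y * h y i l) := by
  have hsy : (h y).IsSymm := hs.self_of_nhdsWithin hy
  -- Lowering the upper index gives the Christoffel symbols of the first kind; in the sum of the two
  -- symbols all derivatives but `∂ₖ hᵢⱼ` cancel.
  have key : ∀ i j, ∑ l, christoffel h l k i y * h y j l = (1 / 2)
      * (pderiv k (fun z => h z i j) y + pderiv i (fun z => h z k j) y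
      - pderiv j (fun z => h z k i) y) := by
    intro i j
    rw [← sum_mul_inv_mul hdet (fun l => pderiv k (fun z => h z i l) y
      + pderiv i (fun z => h z k l) y - pderiv l (fun z => h z k i) y) j, Finset.mul_sum]
    refine Finset.sum_congr rfl fun m _ => ?_
    unfold christoffel
    ring
  have e : ∑ l, christoffel h l k i y * h y l j = ∑ l, christoffel h l k i y * h y j l :=
    Finset.sum_congr rfl fun l _ => by rw [hsy.apply l j]
  rw [Finset.sum_add_distrib, e, key, key, pderiv_symm hy hs k j i]
  ring

theorem pderiv_conformal (hy : y ∈ Set.range (𝓡∂ (n + 1))) (hh : SmoothMatrixAt h y)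
    (hX : ContDiffWithinAt ℝ ∞ X (Set.range (𝓡∂ (n + 1))) y) (h0 : X y ≠ 0)
    (l i j : Fin (n + 1)) :
    pderiv l (fun z => ((X z) ^ 2)⁻¹ * h z i j) y
      = ((X y) ^ 2)⁻¹ * (pderiv l (fun z => h z i j) y - 2 * (pderiv l X y / X y) * h y i j) := by
  have hXd := hX.differentiableWithinAt (by simp)
  have hX2 : DifferentiableWithinAt ℝ (fun z => (X z) ^ 2) (Set.range (𝓡∂ (n + 1))) y := hXd.pow 2
  have e : pderiv l (fun z => (X z) ^ 2) y = 2 * X y * pderiv l X y := by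
    simp only [pow_two]
    rw [pderiv_mul l hy hXd hXd]
    ring
  rw [pderiv_mul (f := fun z => ((X z) ^ 2)⁻¹) l hy (hX2.inv (pow_ne_zero 2 h0))
    ((hh i j).differentiableWithinAt (by simp)),
    pderiv_inv (f := fun z => (X z) ^ 2) l hy hX2 (pow_ne_zero 2 h0), e]
  field_simp
  ring

/-- Differentiating the factor `X⁻²` adds `-2 (∂X / X) h` to each derivative of `h`, while the
scalings of `h` and `h⁻¹` cancel. The correction is governed by the one-form `-dX / X = d log X⁻¹`
(for `X > 0`) and its gradient. -/
theorem christoffel_conformal (hy : y ∈ Set.range (𝓡∂ (n + 1))) (hh : SmoothMatrixAt h y)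
    (hdet : (h y).det ≠ 0)
    (hX : ContDiffWithinAt ℝ ∞ X (Set.range (𝓡∂ (n + 1))) y) (h0 : X y ≠ 0)
    (k i j : Fin (n + 1)) (hs : (h y).IsSymm) :
    christoffel (fun z => ((X z) ^ 2)⁻¹ • h z) k i j y
      = christoffel h k i j y + (if k = j then -(pderiv i X y / X y) else 0)
        + (if k = i then -(pderiv j X y / X y) else 0)
        - h y i j * ∑ l, (h y)⁻¹ k l * -(pderiv l X y / X y) := by
  have hinv : (((X y) ^ 2)⁻¹ • h y)⁻¹ = (X y) ^ 2 • (h y)⁻¹ := by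
    refine Matrix.inv_eq_left_inv ?_
    rw [Matrix.smul_mul, Matrix.mul_smul, smul_smul, mul_inv_cancel₀ (pow_ne_zero 2 h0), one_smul,
      Matrix.nonsing_inv_mul _ (isUnit_iff_ne_zero.2 hdet)]
  unfold christoffel
  simp only [hinv, Matrix.smul_apply, smul_eq_mul, pderiv_conformal hy hh hX h0]
  have e : ∀ l, (X y) ^ 2 * (h y)⁻¹ k l
      * (((X y) ^ 2)⁻¹ * (pderiv i (fun z => h z j l) y - 2 * (pderiv i X y / X y) * h y j l)
        + ((X y) ^ 2)⁻¹ * (pderiv j (fun z => h z i l) y - 2 * (pderiv j X y / X y) * h y i l)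
        - ((X y) ^ 2)⁻¹ * (pderiv l (fun z => h z i j) y - 2 * (pderiv l X y / X y) * h y i j))
      = (h y)⁻¹ k l * (pderiv i (fun z => h z j l) y + pderiv j (fun z => h z i l) y
          - pderiv l (fun z => h z i j) y)
        + 2 * (-(pderiv i X y / X y) * ((h y)⁻¹ k l * h y l j))
        + 2 * (-(pderiv j X y / X y) * ((h y)⁻¹ k l * h y l i))
        - 2 * (h y i j * ((h y)⁻¹ k l * -(pderiv l X y / X y))) := by
    intro l
    rw [hs.apply l j, hs.apply l i]
    field_simp
    ring
  simp only [e, Finset.sum_add_distrib, Finset.sum_sub_distrib, ← Finset.mul_sum,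
    sum_inv_mul_mul hdet]
  split_ifs <;> ring

/-- Modulo multiples of the metric, `Ric(X⁻² h) = Ric(h) + (n - 1) X⁻¹ ∇²X`. -/
theorem ricci_conformal (hy : y ∈ Set.range (𝓡∂ (n + 1)))
    (hh : ∀ᶠ z in nhdsWithin y (Set.range (𝓡∂ (n + 1))), SmoothMatrixAt h z)
    (hs : ∀ᶠ z in nhdsWithin y (Set.range (𝓡∂ (n + 1))), (h z).IsSymm)
    (hdet : ∀ᶠ z in nhdsWithin y (Set.range (𝓡∂ (n + 1))), (h z).det ≠ 0)
    (hX : ∀ᶠ z in nhdsWithin y (Set.range (𝓡∂ (n + 1))),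
      ContDiffWithinAt ℝ ∞ X (Set.range (𝓡∂ (n + 1))) z) (h0 : X y ≠ 0) :
    ∃ c : ℝ, ∀ i j, ricci (fun z => ((X z) ^ 2)⁻¹ • h z) y i j
      = ricci h y i j + ((n : ℝ) - 1) * (covDerivForm h (fun z j => pderiv j X z) y i j / X y)
        + c * h y i j := by
  -- `a` is the logarithmic differential of the conformal factor `X⁻¹`, and `V` is its gradient with
  -- respect to `h`.
  set a : Fin (n + 1) → EuclideanSpace ℝ (Fin (n + 1)) → ℝ := fun i z => -(pderiv i X z / X z)
    with ha
  set V : Fin (n + 1) → EuclideanSpace ℝ (Fin (n + 1)) → ℝ := fun k z => ∑ l, (h z)⁻¹ k l * a l z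
  have hhy := hh.self_of_nhdsWithin hy
  have hsy := hs.self_of_nhdsWithin hy
  have hdety := hdet.self_of_nhdsWithin hy
  have hXy := hX.self_of_nhdsWithin hy
  have haS : ∀ i, ContDiffWithinAt ℝ ∞ (a i) (Set.range (𝓡∂ (n + 1))) y := fun i =>
    ((contDiffWithinAt_pderiv i hy hXy).div hXy h0).neg
  have hVS : ∀ k, ContDiffWithinAt ℝ ∞ (V k) (Set.range (𝓡∂ (n + 1))) y := fun k =>
    ContDiffWithinAt.sum fun l _ => (hhy.inv hdety k l).mul (haS l)
  have hcS := hhy.christoffel hy hdety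
  have had := fun i => (haS i).differentiableWithinAt (by simp)
  have hVd := fun i => (hVS i).differentiableWithinAt (by simp)
  have hcd := fun k i j => (hcS k i j).differentiableWithinAt (by simp)
  have hhd := fun i j => (hhy i j).differentiableWithinAt (by simp)
  have haV : ∀ z, (h z).det ≠ 0 → ∀ i, ∑ k, h z i k * V k z = a i z := fun z hz i =>
    sum_mul_inv_mul hz (fun l => a l z) i
  have hC : ∀ k i j, (christoffel (fun z => ((X z) ^ 2)⁻¹ • h z) k i j)
      =ᶠ[nhdsWithin y (Set.range (𝓡∂ (n + 1)))]
      fun z => christoffel h k i j z + ((if k = j then a i z else 0)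
        + (if k = i then a j z else 0)) - h z i j * V k z := by
    intro k i j
    filter_upwards [hh, hs, hdet, hX, hXy.continuousWithinAt.eventually_ne h0,
      self_mem_nhdsWithin] with z h1 h2 h3 h4 h5 h6
    rw [christoffel_conformal h6 h1 h3 h4 h5 k i j h2]
    ring
  -- Contracting before differentiating eliminates `V`, so the second derivative term of Ricci
  -- involves only `∂ⱼ aᵢ`.
  have hT : ∀ i, (fun z => ∑ k, christoffel (fun z => ((X z) ^ 2)⁻¹ • h z) k i k z)
      =ᶠ[nhdsWithin y (Set.range (𝓡∂ (n + 1)))]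
      fun z => ∑ k, christoffel h k i k z + a i z * ((n : ℝ) + 1) := by
    intro i
    filter_upwards [Filter.eventually_all.2 fun k => hC k i k, hdet] with z hz h3
    simp only [hz, Finset.sum_add_distrib, Finset.sum_sub_distrib, Finset.sum_ite_eq',
      Finset.mem_univ, if_true, Finset.sum_const, Finset.card_univ, Fintype.card_fin, haV z h3,
      nsmul_eq_mul]
    push_cast
    ring
  have hite : ∀ (p : Prop) [Decidable p] (i : Fin (n + 1)),
      DifferentiableWithinAt ℝ (fun z => if p then a i z else 0) (Set.range (𝓡∂ (n + 1))) y := by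
    intro p _ i
    split_ifs
    · exact had i
    · exact differentiableWithinAt_const _
  have hpite : ∀ (p : Prop) [Decidable p] (l i : Fin (n + 1)),
      pderiv l (fun z => if p then a i z else 0) y = if p then pderiv l (a i) y else 0 := by
    intro p _ l i
    split_ifs
    · rfl
    · exact pderiv_const l 0
  have hd1 : ∀ i j, ∑ k, pderiv k (christoffel (fun z => ((X z) ^ 2)⁻¹ • h z) k i j) y
      = ∑ k, pderiv k (christoffel h k i j) y + (pderiv j (a i) y + pderiv i (a j) y
        - ∑ k, pderiv k (fun z => h z i j) y * V k y - h y i j * ∑ k, pderiv k (V k) y) := by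
    intro i j
    rw [← ricci_linear_conformal (fun k i j => pderiv k (fun z => h z i j) y) (h y)
      (fun k i => pderiv k (a i) y) (fun k l => pderiv k (V l) y) (fun k => V k y) i j,
      ← Finset.sum_add_distrib]
    refine Finset.sum_congr rfl fun k _ => ?_
    rw [pderiv_congr k hy (hC k i j), pderiv_sub k hy
      ((hcd k i j).fun_add ((hite _ i).fun_add (hite _ j))) ((hhd i j).fun_mul (hVd k)),
      pderiv_add k hy (hcd k i j) ((hite _ i).fun_add (hite _ j)),
      pderiv_add k hy (hite _ i) (hite _ j), hpite, hpite, pderiv_mul k hy (hhd i j) (hVd k)]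
    ring
  have hCd : ∀ k i j, DifferentiableWithinAt ℝ (christoffel (fun z => ((X z) ^ 2)⁻¹ • h z) k i j)
      (Set.range (𝓡∂ (n + 1))) y := by
    intro k i j
    exact (((hcd k i j).add ((hite _ i).add (hite _ j))).sub
      ((hhd i j).mul (hVd k))).congr_of_eventuallyEq (hC k i j) ((hC k i j).self_of_nhdsWithin hy)
  have hd2 : ∀ i j, ∑ k, pderiv j (christoffel (fun z => ((X z) ^ 2)⁻¹ • h z) k i k) y
      = ∑ k, pderiv j (christoffel h k i k) y + pderiv j (a i) y * ((n : ℝ) + 1) := by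
    intro i j
    rw [← pderiv_sum _ _ j hy fun k _ => hCd k i k, pderiv_congr j hy (hT i),
      pderiv_add j hy (DifferentiableWithinAt.fun_sum fun k _ => hcd k i k) ((had i).mul_const _),
      pderiv_mul_const j hy (had i), pderiv_sum _ _ j hy fun k _ => hcd k i k]
  -- Ricci contains `-(n - 1) ∂ᵢ aⱼ`; the term `aᵢ aⱼ` here cancels the one produced by
  -- `ricci_quadratic_conformal`.
  have hda : ∀ i j, pderiv i (a j) y
      = -(pderiv i (pderiv j X) y / X y) + a i y * a j y := by
    intro i j
    have hp := (contDiffWithinAt_pderiv j hy hXy).differentiableWithinAt (by simp)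
    have hXd := hXy.differentiableWithinAt (by simp)
    have e : a j = fun z => (pderiv j X z * (X z)⁻¹) * (-1) := by
      funext z
      simp only [ha]
      ring
    rw [e, pderiv_mul_const i hy (hp.fun_mul (hXd.fun_inv h0)),
      pderiv_mul (f' := fun z => (X z)⁻¹) i hy hp (hXd.inv h0), pderiv_inv i hy hXd h0]
    simp only [ha]
    field_simp
    ring
  -- The witness collects the coefficients of `h` from the linear part (minus the coordinate
  -- divergence of `V`) and from the quadratic part.
  refine ⟨-(∑ k, pderiv k (V k) y) - (∑ l, (∑ k, christoffel h k k l y) * V l y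
    + ((n : ℝ) - 1) * ∑ l, a l y * V l y), fun i j => ?_⟩
  have hq := ricci_quadratic_conformal (fun k i j => christoffel h k i j y)
    (fun k i j => christoffel (fun z => ((X z) ^ 2)⁻¹ • h z) k i j y) (h y) (fun i => a i y)
    (fun k => V k y) (christoffel_symm hy hs) (fun i j => hsy.apply j i) (haV y hdety)
    (fun k i j => by rw [(hC k i j).self_of_nhdsWithin hy]; ring) i j
  -- Metric compatibility turns the derivatives of `h` along `V` into the mixed `Γ h V` terms of the
  -- quadratic part, with the opposite sign in Ricci, so both drop out.
  have hm : ∑ k, pderiv k (fun z => h z i j) y * V k y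
      = ∑ k, ∑ l, (christoffel h l k i y * h y l j + christoffel h l k j y * h y i l) * V k y := by
    refine Finset.sum_congr rfl fun k _ => ?_
    rw [pderiv_metric hy hs hdety, Finset.sum_mul]
  have hH : covDerivForm h (fun z j => pderiv j X z) y i j / X y
      = pderiv i (pderiv j X) y / X y + ∑ l, a l y * christoffel h l i j y := by
    unfold covDerivForm
    rw [sub_div, Finset.sum_div, sub_eq_add_neg, ← Finset.sum_neg_distrib]
    congr 1
    refine Finset.sum_congr rfl fun l _ => ?_
    simp only [ha]
    ring
  unfold ricci
  simp only [Finset.sum_sub_distrib] at hq ⊢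
  rw [hd1, hd2, hq, hm, hH, hda, hda, pderiv_comm j i hy hXy]
  ring

end Conformal

end PoincareEinstein

namespace PoincareEinstein

/-! ### Extrinsic geometry of `{y 0 = 0}` and the local theorem. -/

section Boundary

variable {n : ℕ} {h : EuclideanSpace ℝ (Fin (n + 1)) → Matrix (Fin (n + 1)) (Fin (n + 1)) ℝ}
  {X : EuclideanSpace ℝ (Fin (n + 1)) → ℝ} {y : EuclideanSpace ℝ (Fin (n + 1))}

theorem sum_mul_unitConormal (c : Fin (n + 1) → ℝ) :
    ∑ k, c k * unitConormal h y k = c 0 * (1 / √((h y)⁻¹ 0 0)) := by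
  unfold unitConormal
  simp only [mul_ite, mul_zero, Finset.sum_ite_eq', Finset.mem_univ, if_true]

theorem inv_mul_unitConormal_sq (hpos : 0 < (h y)⁻¹ 0 0) :
    (h y)⁻¹ 0 0 * (1 / √((h y)⁻¹ 0 0)) * (1 / √((h y)⁻¹ 0 0)) = 1 := by
  have h1 := Real.mul_self_sqrt hpos.le
  have h2 := (Real.sqrt_pos.2 hpos).ne'
  field_simp
  nlinarith

/-- Since `n⁰ n₀ = 1`, the projection takes values in vectors tangent to the boundary. Hence only
tangential components of `∇n` enter the second fundamental form. -/
theorem tangentialProj_zero (hpos : 0 < (h y)⁻¹ 0 0) (a : Fin (n + 1)) :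
    tangentialProj h y 0 a = 0 := by
  unfold tangentialProj
  rw [sum_mul_unitConormal]
  by_cases ha : a = 0
  · subst ha
    have := inv_mul_unitConormal_sq hpos
    simp only [if_true, unitConormal]
    linarith
  · simp [unitConormal, ha, Ne.symm ha]

theorem sum_tangentialProj_mul_metric (hs : (h y).IsSymm) (hdet : (h y).det ≠ 0)
    (a d : Fin (n + 1)) :
    ∑ c, tangentialProj h y c a * h y c d
      = h y a d - unitConormal h y a * unitConormal h y d := by
  have e : ∑ c, h y d c * ∑ k, (h y)⁻¹ c k * unitConormal h y k = unitConormal h y d :=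
    sum_mul_inv_mul hdet _ d
  rw [← e, Finset.mul_sum]
  have e' : ∀ c, tangentialProj h y c a * h y c d = (if c = a then h y c d else 0)
      - unitConormal h y a * (h y d c * ∑ k, (h y)⁻¹ c k * unitConormal h y k) := by
    intro c
    unfold tangentialProj
    rw [hs.apply d c]
    split_ifs <;> ring
  simp only [e', Finset.sum_sub_distrib, Finset.sum_ite_eq', Finset.mem_univ, if_true]

/-- Lowering an index of `Π` gives `h - n ⊗ n`, and the second projection changes nothing more
because `n` annihilates the image of `Π`. -/
theorem sum_tangentialProj_metric (hs : (h y).IsSymm) (hdet : (h y).det ≠ 0)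
    (hpos : 0 < (h y)⁻¹ 0 0) (a b : Fin (n + 1)) :
    ∑ c, ∑ d, tangentialProj h y c a * tangentialProj h y d b * h y c d
      = firstFundamentalForm h y a b := by
  have hN : ∑ d, tangentialProj h y d b * unitConormal h y d = 0 := by
    rw [sum_mul_unitConormal (fun d => tangentialProj h y d b), tangentialProj_zero hpos, zero_mul]
  rw [Finset.sum_comm]
  have e : ∀ d, ∑ c, tangentialProj h y c a * tangentialProj h y d b * h y c d
      = tangentialProj h y d b * h y d a
        - unitConormal h y a * (tangentialProj h y d b * unitConormal h y d) := by
    intro d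
    have := sum_tangentialProj_mul_metric hs hdet a d
    rw [hs.apply a d, ← mul_assoc, mul_comm (unitConormal h y a), mul_assoc, ← mul_sub,
      ← this, Finset.mul_sum]
    exact Finset.sum_congr rfl fun c _ => by ring
  simp only [e, Finset.sum_sub_distrib, ← Finset.mul_sum, hN,
    sum_tangentialProj_mul_metric hs hdet b a]
  rw [hs.apply a b]
  unfold firstFundamentalForm
  ring

/-- The trace of `h` is `n + 1`, and `n ⊗ n` removes `|n|² = 1`. -/
theorem trace_firstFundamentalForm (hs : (h y).IsSymm) (hdet : (h y).det ≠ 0)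
    (hpos : 0 < (h y)⁻¹ 0 0) :
    ∑ a, ∑ b, (h y)⁻¹ a b * firstFundamentalForm h y a b = n := by
  have e : ∀ a, ∑ b, (h y)⁻¹ a b * firstFundamentalForm h y a b
      = 1 - (h y)⁻¹ a 0 * (1 / √((h y)⁻¹ 0 0)) * unitConormal h y a := by
    intro a
    have h1 := sum_inv_mul_mul hdet a a
    rw [if_pos rfl] at h1
    rw [← sum_mul_unitConormal (fun b => (h y)⁻¹ a b), ← h1, Finset.sum_mul,
      ← Finset.sum_sub_distrib]
    refine Finset.sum_congr rfl fun b _ => ?_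
    unfold firstFundamentalForm
    rw [hs.apply b a]
    ring
  simp only [e, Finset.sum_sub_distrib]
  rw [sum_mul_unitConormal (fun a => (h y)⁻¹ a 0 * (1 / √((h y)⁻¹ 0 0))),
    inv_mul_unitConormal_sq hpos]
  simp

/-- If the Hessian of a boundary defining function is pure trace at a boundary point, the boundary
is umbilic there. -/
theorem umbilic_of_hessian (hn : n ≠ 0) (hs : (h y).IsSymm) (hdet : (h y).det ≠ 0)
    (hpos : 0 < (h y)⁻¹ 0 0) (hX0 : pderiv 0 X y ≠ 0) (hX1 : ∀ k, k ≠ 0 → pderiv k X y = 0)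
    (hX2 : ∀ i j, i ≠ 0 → j ≠ 0 → pderiv i (pderiv j X) y = 0) (c : ℝ)
    (hhess : ∀ i j, covDerivForm h (fun z j => pderiv j X z) y i j = c * h y i j) :
    secondFundamentalForm h y = meanCurvature h y • firstFundamentalForm h y := by
  -- The ratio `n₀ / ∂₀X` converts tangential components of `∇²X` into those of `∇n`; it multiplies
  -- the Hessian's factor `c`.
  set t : ℝ := 1 / √((h y)⁻¹ 0 0) * c / pderiv 0 X y with ht
  have hcov : ∀ i j, i ≠ 0 → j ≠ 0 → covDerivForm h (unitConormal h) y i j = t * h y i j := by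
    intro i j hi hj
    have h1 := hhess i j
    unfold covDerivForm at h1 ⊢
    have e0 : pderiv i (fun z => unitConormal h z j) y = 0 := by
      have : (fun z => unitConormal h z j) = fun _ => (0 : ℝ) := by
        funext z
        simp [unitConormal, hj]
      rw [this, pderiv_const]
    have e1 : ∑ k, christoffel h k i j y * pderiv k X y
        = christoffel h 0 i j y * pderiv 0 X y :=
      Finset.sum_eq_single 0 (fun k _ hk => by rw [hX1 k hk, mul_zero]) (by simp)
    have e2 : pderiv i (fun z => pderiv j X z) y = 0 := hX2 i j hi hj
    rw [e1, e2] at h1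
    rw [sum_mul_unitConormal (fun k => christoffel h k i j y), e0, ht]
    field_simp
    linear_combination h1
  have hII : ∀ a b, secondFundamentalForm h y a b = t * firstFundamentalForm h y a b := by
    intro a b
    rw [← sum_tangentialProj_metric hs hdet hpos, Finset.mul_sum]
    unfold secondFundamentalForm
    refine Finset.sum_congr rfl fun i _ => ?_
    rw [Finset.mul_sum]
    refine Finset.sum_congr rfl fun j _ => ?_
    by_cases hi : i = 0
    · subst hi
      rw [tangentialProj_zero hpos]
      ring
    by_cases hj : j = 0
    · subst hj
      rw [tangentialProj_zero hpos]
      ring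
    rw [hcov i j hi hj]
    ring
  have hH : meanCurvature h y = t := by
    unfold meanCurvature
    have e : ∀ a b, (h y)⁻¹ a b * secondFundamentalForm h y a b
        = t * ((h y)⁻¹ a b * firstFundamentalForm h y a b) := by
      intro a b
      rw [hII]
      ring
    simp only [e, ← Finset.mul_sum, trace_firstFundamentalForm hs hdet hpos]
    field_simp
  ext a b
  rw [hII, hH, Matrix.smul_apply, smul_eq_mul]

/-- The local form of the theorem: a metric `h` on the half-space near a boundary point `y`, with a
boundary defining function `X` such that `X⁻² h` is Einstein, has umbilic boundary at `y`. -/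
theorem umbilic_of_einstein (hn : 2 ≤ n) (hy : y ∈ Set.range (𝓡∂ (n + 1))) (hy0 : y 0 = 0)
    (hh : ∀ᶠ z in nhdsWithin y (Set.range (𝓡∂ (n + 1))), SmoothMatrixAt h z)
    (hp : ∀ᶠ z in nhdsWithin y (Set.range (𝓡∂ (n + 1))), (h z).PosDef)
    (hX : ∀ᶠ z in nhdsWithin y (Set.range (𝓡∂ (n + 1))),
      ContDiffWithinAt ℝ ∞ X (Set.range (𝓡∂ (n + 1))) z)
    (hXb : ∀ᶠ z in nhdsWithin y (Set.range (𝓡∂ (n + 1))), z 0 = 0 → X z = 0)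
    (hXi : ∀ᶠ z in nhdsWithin y (Set.range (𝓡∂ (n + 1))), 0 < z 0 → X z ≠ 0)
    (hdX : pderiv 0 X y ≠ 0)
    (hE : ∀ᶠ z in nhdsWithin y (Set.range (𝓡∂ (n + 1))), 0 < z 0 →
      ricci (fun w => ((X w) ^ 2)⁻¹ • h w) z = (-(n : ℝ)) • (((X z) ^ 2)⁻¹ • h z)) :
    secondFundamentalForm h y = meanCurvature h y • firstFundamentalForm h y := by
  have hn1 : (n : ℝ) - 1 ≠ 0 := by
    have : (2 : ℝ) ≤ n := by exact_mod_cast hn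
    linarith
  have hs : ∀ᶠ z in nhdsWithin y (Set.range (𝓡∂ (n + 1))), (h z).IsSymm :=
    hp.mono fun z hz => by simpa using hz.isHermitian
  have hdet : ∀ᶠ z in nhdsWithin y (Set.range (𝓡∂ (n + 1))), (h z).det ≠ 0 :=
    hp.mono fun z hz => hz.det_pos.ne'
  have hpy := hp.self_of_nhdsWithin hy
  have hsy := hs.self_of_nhdsWithin hy
  have hdety := hdet.self_of_nhdsWithin hy
  have hXy := hX.self_of_nhdsWithin hy
  have hhy := hh.self_of_nhdsWithin hy
  have hX0 : X y = 0 := hXb.self_of_nhdsWithin hy hy0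
  -- This is needed at all boundary points near `y`, not only at `y`: the tangential derivatives of
  -- `X` are then themselves functions vanishing on the boundary, and can be differentiated
  -- tangentially again.
  have hd1 : ∀ᶠ z in nhdsWithin y (Set.range (𝓡∂ (n + 1))), z 0 = 0 →
      ∀ k : Fin (n + 1), k ≠ 0 → pderiv k X z = 0 := by
    filter_upwards [eventually_eventually_nhdsWithin.2 hXb, hX] with z h1 h2 hz0 k hk
    exact pderiv_eq_zero_of_vanish hk hz0 (h2.differentiableWithinAt (by simp)) h1
  let A : EuclideanSpace ℝ (Fin (n + 1)) → Fin (n + 1) → Fin (n + 1) → ℝ := fun z i j =>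
    X z * ricci h z i j + ((n : ℝ) - 1) * covDerivForm h (fun z j => pderiv j X z) z i j
  -- Being a multiple of `h` is expressed by cross-multiplying with the `00` entry. This avoids the
  -- factor, which involves inverse powers of `X`, and leaves an equation between continuous
  -- functions that survives the limit.
  have hA : ∀ᶠ z in nhdsWithin y (Set.range (𝓡∂ (n + 1))), 0 < z 0 →
      ∀ i j, A z i j * h z 0 0 - A z 0 0 * h z i j = 0 := by
    filter_upwards [eventually_eventually_nhdsWithin.2 hh, eventually_eventually_nhdsWithin.2 hs,
      eventually_eventually_nhdsWithin.2 hdet, eventually_eventually_nhdsWithin.2 hX, hXi, hE,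
      self_mem_nhdsWithin] with z h1 h2 h3 h4 h5 h6 hz hz0 i j
    obtain ⟨c, hc⟩ := ricci_conformal hz h1 h2 h3 h4 (h5 hz0)
    rw [h6 hz0] at hc
    have key : ∀ i j, A z i j = X z * (-(n : ℝ) * ((X z) ^ 2)⁻¹ - c) * h z i j := by
      intro i j
      have h7 := hc i j
      simp only [Matrix.smul_apply, smul_eq_mul] at h7
      have h8 := h5 hz0
      simp only [A]
      field_simp at h7 ⊢
      linear_combination -h7
    rw [key, key]
    ring
  have hcont : ∀ i j, ContinuousWithinAt (fun z => A z i j * h z 0 0 - A z 0 0 * h z i j)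
      (Set.range (𝓡∂ (n + 1))) y := by
    have h1 := contDiffWithinAt_ricci hy hhy hdety
    have h2 := contDiffWithinAt_hessian hy hhy hdety hXy
    have h3 : ∀ i j, ContDiffWithinAt ℝ ∞ (fun z => A z i j) (Set.range (𝓡∂ (n + 1))) y :=
      fun i j => (hXy.mul (h1 i j)).add (contDiffWithinAt_const.mul (h2 i j))
    intro i j
    exact (((h3 i j).mul (hhy 0 0)).sub ((h3 0 0).mul (hhy i j))).continuousWithinAt
  have hA0 : ∀ i j, A y i j * h y 0 0 - A y 0 0 * h y i j = 0 := by
    intro i j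
    have hI : interior (Set.range (𝓡∂ (n + 1))) = {z | 0 < z 0} :=
      interior_range_modelWithCornersEuclideanHalfSpace (n + 1)
    have hne : (nhdsWithin y (interior (Set.range (𝓡∂ (n + 1))))).NeBot :=
      mem_closure_iff_nhdsWithin_neBot.1 ((𝓡∂ (n + 1)).range_subset_closure_interior hy)
    have hle : nhdsWithin y (interior (Set.range (𝓡∂ (n + 1))))
        ≤ nhdsWithin y (Set.range (𝓡∂ (n + 1))) := nhdsWithin_mono y interior_subset
    refine tendsto_nhds_unique ((hcont i j).mono_left hle) (tendsto_const_nhds.congr' ?_)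
    filter_upwards [hle hA, self_mem_nhdsWithin] with z hz hz0
    rw [hI] at hz0
    exact (hz hz0 i j).symm
  have hinv : 0 < (h y)⁻¹ 0 0 := hpy.inv.diag_pos
  have h00 : 0 < h y 0 0 := hpy.diag_pos
  refine umbilic_of_hessian (X := X) (by omega) hsy hdety hinv hdX
    (hd1.self_of_nhdsWithin hy hy0) (fun i j hi hj => ?_)
    -- The trace factor is read off from the `00` entry, as `h₀₀ > 0`.
    (covDerivForm h (fun z j => pderiv j X z) y 0 0 / h y 0 0) fun i j => ?_
  · refine pderiv_eq_zero_of_vanish hi hy0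
      ((contDiffWithinAt_pderiv j hy hXy).differentiableWithinAt (by simp)) ?_
    filter_upwards [hd1] with z hz hz0 using hz hz0 j hj
  · have h1 := hA0 i j
    simp only [A, hX0, zero_mul, zero_add] at h1
    field_simp
    refine mul_left_cancel₀ hn1 ?_
    linear_combination h1

end Boundary

end PoincareEinstein

namespace PoincareEinstein

/-! ### From the manifold to coordinates: frames, smoothness, positivity, boundary. -/

section Charts

theorem extend_target_mem_nhdsWithin_of_mem {n : ℕ} {M : Type*} [TopologicalSpace M]
    {e : OpenPartialHomeomorph M (EuclideanHalfSpace (n + 1))}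
    {y : EuclideanSpace ℝ (Fin (n + 1))} (hy : y ∈ (e.extend (𝓡∂ (n + 1))).target) :
    (e.extend (𝓡∂ (n + 1))).target ∈ nhdsWithin y (Set.range (𝓡∂ (n + 1))) := by
  have h1 : (e.extend (𝓡∂ (n + 1))).symm y ∈ e.source := by
    have := (e.extend (𝓡∂ (n + 1))).map_target hy
    rwa [e.extend_source] at this
  have h2 := e.extend_target_mem_nhdsWithin (I := 𝓡∂ (n + 1)) h1
  rwa [(e.extend (𝓡∂ (n + 1))).right_inv hy] at h2

variable {n : ℕ} {M : Type*} [TopologicalSpace M] [ChartedSpace (EuclideanHalfSpace (n + 1)) M]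
  {e : OpenPartialHomeomorph M (EuclideanHalfSpace (n + 1))}
  {y : EuclideanSpace ℝ (Fin (n + 1))}

/-- The derivative of the inverse of the chart `e`, at the point with coordinates `y`: it sends the
standard basis to the coordinate vector fields. -/
noncomputable def coordFrame (e : OpenPartialHomeomorph M (EuclideanHalfSpace (n + 1)))
    (y : EuclideanSpace ℝ (Fin (n + 1))) :
    EuclideanSpace ℝ (Fin (n + 1)) →L[ℝ]
      TangentSpace (𝓡∂ (n + 1)) ((e.extend (𝓡∂ (n + 1))).symm y) :=
  mfderivWithin 𝓘(ℝ, EuclideanSpace ℝ (Fin (n + 1))) (𝓡∂ (n + 1))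
    (e.extend (𝓡∂ (n + 1))).symm (Set.range (𝓡∂ (n + 1))) y

theorem coordFrame_apply (v : EuclideanSpace ℝ (Fin (n + 1))) :
    coordFrame e y v = ∑ i, v i • coordVector e i y := by
  have h : v = ∑ i, v i • (EuclideanSpace.single i (1 : ℝ) : EuclideanSpace ℝ (Fin (n + 1))) := by
    ext j
    simp [Finset.sum_apply, Pi.single_apply]
  conv_lhs => rw [h]
  rw [map_sum]
  exact Finset.sum_congr rfl fun i _ => map_smul _ _ _

variable [IsManifold (𝓡∂ (n + 1)) ∞ M]

theorem contMDiffWithinAt_extend_symm_range (he : e ∈ atlas (EuclideanHalfSpace (n + 1)) M)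
    (hy : y ∈ (e.extend (𝓡∂ (n + 1))).target) :
    ContMDiffWithinAt 𝓘(ℝ, EuclideanSpace ℝ (Fin (n + 1))) (𝓡∂ (n + 1)) ∞
      (e.extend (𝓡∂ (n + 1))).symm (Set.range (𝓡∂ (n + 1))) y := by
  have h := contMDiffOn_extend_symm (I := 𝓡∂ (n + 1)) (n := ∞)
    (IsManifold.subset_maximalAtlas he)
  rw [← e.extend_target'] at h
  exact (h y hy).mono_of_mem_nhdsWithin (extend_target_mem_nhdsWithin_of_mem hy)

theorem mdifferentiableAt_extend (he : e ∈ atlas (EuclideanHalfSpace (n + 1)) M) {p : M}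
    (hp : p ∈ e.source) : MDifferentiableAt (𝓡∂ (n + 1))
      𝓘(ℝ, EuclideanSpace ℝ (Fin (n + 1))) (e.extend (𝓡∂ (n + 1))) p :=
  (e.contMDiffAt_extend (n := ∞) (IsManifold.subset_maximalAtlas he) hp).mdifferentiableAt
    (by simp)

/-- Chain rule for the chart composed with its inverse, which is the identity on the target, a
neighbourhood of `y` within the half-space. -/
theorem mfderiv_extend_comp_symm (he : e ∈ atlas (EuclideanHalfSpace (n + 1)) M)
    (hy : y ∈ (e.extend (𝓡∂ (n + 1))).target) :
    (mfderiv (𝓡∂ (n + 1)) 𝓘(ℝ, EuclideanSpace ℝ (Fin (n + 1))) (e.extend (𝓡∂ (n + 1)))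
      ((e.extend (𝓡∂ (n + 1))).symm y)).comp
      (mfderivWithin 𝓘(ℝ, EuclideanSpace ℝ (Fin (n + 1))) (𝓡∂ (n + 1))
        (e.extend (𝓡∂ (n + 1))).symm (Set.range (𝓡∂ (n + 1))) y)
      = ContinuousLinearMap.id ℝ _ := by
  have U : UniqueMDiffWithinAt 𝓘(ℝ, EuclideanSpace ℝ (Fin (n + 1))) (Set.range (𝓡∂ (n + 1))) y :=
    (𝓡∂ (n + 1)).uniqueMDiffOn y (e.extend_target_subset_range hy)
  have h1 : (e.extend (𝓡∂ (n + 1))).symm y ∈ e.source := by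
    have := (e.extend (𝓡∂ (n + 1))).map_target hy
    rwa [e.extend_source] at this
  rw [← mfderiv_comp_mfderivWithin _ (mdifferentiableAt_extend he h1)
    ((contMDiffWithinAt_extend_symm_range he hy).mdifferentiableWithinAt (by simp)) U,
    ← mfderivWithin_id U]
  apply Filter.EventuallyEq.mfderivWithin_eq
  · filter_upwards [extend_target_mem_nhdsWithin_of_mem hy] with z hz
    simp only [Function.comp_def, PartialEquiv.right_inv _ hz, id_eq]
  · simp only [Function.comp_def, PartialEquiv.right_inv _ hy, id_eq]

theorem coordFrame_injective (he : e ∈ atlas (EuclideanHalfSpace (n + 1)) M)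
    (hy : y ∈ (e.extend (𝓡∂ (n + 1))).target) : Function.Injective (coordFrame e y) :=
  Function.LeftInverse.injective
    (g := mfderiv (𝓡∂ (n + 1)) 𝓘(ℝ, EuclideanSpace ℝ (Fin (n + 1))) (e.extend (𝓡∂ (n + 1)))
      ((e.extend (𝓡∂ (n + 1))).symm y))
    fun v => DFunLike.congr_fun (mfderiv_extend_comp_symm he hy) v

theorem coordFrame_surjective (he : e ∈ atlas (EuclideanHalfSpace (n + 1)) M)
    (hy : y ∈ (e.extend (𝓡∂ (n + 1))).target) : Function.Surjective (coordFrame e y) := by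
  -- The tangent space is by definition the model space, so the frame is an endomorphism of a
  -- finite-dimensional space, and injectivity gives surjectivity.
  let L : EuclideanSpace ℝ (Fin (n + 1)) →ₗ[ℝ] EuclideanSpace ℝ (Fin (n + 1)) :=
    (coordFrame e y).toLinearMap
  have hL : Function.Injective L := coordFrame_injective he hy
  have hL' : Function.Surjective L := LinearMap.injective_iff_surjective.1 hL
  exact hL'

/-- The field is the derivative of the smooth inverse chart applied to a constant vector field; at
order `∞` the loss of one derivative is harmless. -/
theorem contMDiffWithinAt_coordVector (he : e ∈ atlas (EuclideanHalfSpace (n + 1)) M)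
    (hy : y ∈ (e.extend (𝓡∂ (n + 1))).target) (i : Fin (n + 1)) :
    ContMDiffWithinAt 𝓘(ℝ, EuclideanSpace ℝ (Fin (n + 1))) (𝓡∂ (n + 1)).tangent ∞
      (fun z => (⟨(e.extend (𝓡∂ (n + 1))).symm z, coordVector e i z⟩ :
        TangentBundle (𝓡∂ (n + 1)) M)) (Set.range (𝓡∂ (n + 1))) y := by
  have hS := contMDiffWithinAt_extend_symm_range he hy
  have hyr := e.extend_target_subset_range hy
  have : IsManifold (𝓡∂ (n + 1)) 1 M := IsManifold.of_le (n := ∞) (by simp)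
  have hv : ContMDiffWithinAt 𝓘(ℝ, EuclideanSpace ℝ (Fin (n + 1)))
      𝓘(ℝ, EuclideanSpace ℝ (Fin (n + 1))).tangent ∞
      (fun z => (⟨z, (EuclideanSpace.single i (1 : ℝ) : EuclideanSpace ℝ (Fin (n + 1)))⟩ :
        TangentBundle 𝓘(ℝ, EuclideanSpace ℝ (Fin (n + 1))) (EuclideanSpace ℝ (Fin (n + 1)))))
      (Set.range (𝓡∂ (n + 1))) y :=
    contMDiffWithinAt_vectorSpace_iff_contDiffWithinAt.2 contDiffWithinAt_const
  exact ContMDiffWithinAt.clm_apply_of_inCoordinates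
    (hS.mfderivWithin_const (m := ∞) (by simp) hyr (𝓡∂ (n + 1)).uniqueMDiffOn) hv hS

theorem smoothMatrixAt_coordMatrix (g : SmoothMetric n M)
    (he : e ∈ atlas (EuclideanHalfSpace (n + 1)) M)
    (hy : y ∈ (e.extend (𝓡∂ (n + 1))).target) : SmoothMatrixAt (coordMatrix g.inner e) y := by
  intro i j
  have : ContMDiffWithinAt 𝓘(ℝ, EuclideanSpace ℝ (Fin (n + 1)))
      ((𝓡∂ (n + 1)).prod 𝓘(ℝ)) ∞
      (fun z => Bundle.TotalSpace.mk' ℝ (E := Bundle.Trivial M ℝ) ((e.extend (𝓡∂ (n + 1))).symm z)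
        (g.inner ((e.extend (𝓡∂ (n + 1))).symm z) (coordVector e i z) (coordVector e j z)))
      (Set.range (𝓡∂ (n + 1))) y := by
    apply ContMDiffWithinAt.clm_bundle_apply₂ (F₁ := EuclideanSpace ℝ (Fin (n + 1)))
      (F₂ := EuclideanSpace ℝ (Fin (n + 1)))
    · exact ContMDiffAt.comp_contMDiffWithinAt y g.contMDiff.contMDiffAt
        (contMDiffWithinAt_extend_symm_range he hy)
    · exact contMDiffWithinAt_coordVector he hy i
    · exact contMDiffWithinAt_coordVector he hy j
  simp only [Bundle.contMDiffWithinAt_totalSpace] at this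
  exact this.2.contDiffWithinAt

/-- The quadratic form of the matrix at `v` is `g` evaluated twice on the image of `v` under
`coordFrame`, which is nonzero for `v ≠ 0` by injectivity. -/
theorem posDef_coordMatrix (g : SmoothMetric n M)
    (he : e ∈ atlas (EuclideanHalfSpace (n + 1)) M)
    (hy : y ∈ (e.extend (𝓡∂ (n + 1))).target) : (coordMatrix g.inner e y).PosDef := by
  refine Matrix.PosDef.of_dotProduct_mulVec_pos ?_ fun v hv => ?_
  · ext i j
    exact g.symm _ _ _
  · have h0 : coordFrame e y (WithLp.toLp 2 v) ≠ 0 := by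
      intro h
      have h1 := coordFrame_injective he hy (h.trans (map_zero (coordFrame e y)).symm)
      apply hv
      funext k
      exact congrArg (fun w : EuclideanSpace ℝ (Fin (n + 1)) => w k) h1
    have h1 := g.pos _ _ h0
    rw [coordFrame_apply] at h1
    simp only [map_sum, map_smul, sum_apply, smul_apply, smul_eq_mul] at h1
    refine h1.trans_eq ?_
    simp only [dotProduct, Matrix.mulVec, coordMatrix, Finset.mul_sum, star_trivial]
    rw [Finset.sum_comm]
    refine Finset.sum_congr rfl fun i _ => Finset.sum_congr rfl fun j _ => ?_
    ring

/-- Interior points are defined through the preferred chart at the point; what makes this work is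
that any chart of the atlas detects them. -/
theorem mem_interior_iff_of_mem_target (he : e ∈ atlas (EuclideanHalfSpace (n + 1)) M)
    (hy : y ∈ (e.extend (𝓡∂ (n + 1))).target) :
    (e.extend (𝓡∂ (n + 1))).symm y ∈ (𝓡∂ (n + 1)).interior M ↔ 0 < y 0 := by
  have h1 : (e.extend (𝓡∂ (n + 1))).symm y ∈ e.source := by
    have := (e.extend (𝓡∂ (n + 1))).map_target hy
    rwa [e.extend_source] at this
  have h2 := (𝓡∂ (n + 1)).isInteriorPoint_iff_of_mem_atlas (n := ∞) (by simp) he h1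
  rw [(e.extend (𝓡∂ (n + 1))).right_inv hy] at h2
  have hI : interior (Set.range (𝓡∂ (n + 1))) = {z | 0 < z 0} :=
    interior_range_modelWithCornersEuclideanHalfSpace (n + 1)
  change (𝓡∂ (n + 1)).IsInteriorPoint _ ↔ _
  rw [h2]
  constructor
  · intro h
    have := e.interior_extend_target_subset_interior_range h
    rwa [hI] at this
  · intro h
    have h3 : y ∈ interior (Set.range (𝓡∂ (n + 1))) := by rwa [hI]
    rw [mem_interior_iff_mem_nhds] at h3 ⊢
    have h4 := extend_target_mem_nhdsWithin_of_mem hy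
    rwa [nhdsWithin_eq_nhds.2 h3] at h4

end Charts

/-! ### The global theorem and conformal invariance. -/

section Main

variable {n : ℕ} {M : Type*} [TopologicalSpace M] [ChartedSpace (EuclideanHalfSpace (n + 1)) M]
  [IsManifold (𝓡∂ (n + 1)) ∞ M]

/-- The boundary of a Poincaré–Einstein manifold is totally umbilic. -/
theorem IsPoincareEinstein.isBoundaryTotallyUmbilic (hn : 2 ≤ n) {g : SmoothMetric n M}
    (hg : IsPoincareEinstein g) : IsBoundaryTotallyUmbilic g := by
  obtain ⟨x, hx, hE⟩ := hg
  intro e he p hp hpb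
  set y : EuclideanSpace ℝ (Fin (n + 1)) := e.extend (𝓡∂ (n + 1)) p
  have hy : y ∈ (e.extend (𝓡∂ (n + 1))).target :=
    (e.extend (𝓡∂ (n + 1))).map_source (by rwa [e.extend_source])
  have hyp : (e.extend (𝓡∂ (n + 1))).symm y = p := e.extend_left_inv hp
  have hyr := e.extend_target_subset_range hy
  have hT := extend_target_mem_nhdsWithin_of_mem hy
  have hbd : ∀ z ∈ (e.extend (𝓡∂ (n + 1))).target,
      ((e.extend (𝓡∂ (n + 1))).symm z ∈ (𝓡∂ (n + 1)).boundary M ↔ z 0 = 0) := by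
    intro z hz
    have h1 : z ∈ Set.range (𝓡∂ (n + 1)) := e.extend_target_subset_range hz
    rw [range_modelWithCornersEuclideanHalfSpace] at h1
    have h2 : 0 ≤ z 0 := h1
    rw [← (𝓡∂ (n + 1)).compl_interior, Set.mem_compl_iff, mem_interior_iff_of_mem_target he hz]
    exact ⟨fun h => le_antisymm (not_lt.1 h) h2, fun h => by simp [h]⟩
  have hXs : ∀ z ∈ (e.extend (𝓡∂ (n + 1))).target, ContMDiffWithinAt
      𝓘(ℝ, EuclideanSpace ℝ (Fin (n + 1))) 𝓘(ℝ) ∞ (fun z => x ((e.extend (𝓡∂ (n + 1))).symm z))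
      (Set.range (𝓡∂ (n + 1))) z := fun z hz =>
    hx.smooth.contMDiffAt.comp_contMDiffWithinAt z (contMDiffWithinAt_extend_symm_range he hz)
  have hy0 : y 0 = 0 := (hbd y hy).1 (by rwa [hyp])
  have hXb : ∀ᶠ z in nhdsWithin y (Set.range (𝓡∂ (n + 1))), z 0 = 0 →
      x ((e.extend (𝓡∂ (n + 1))).symm z) = 0 := by
    filter_upwards [hT] with z hz hz0
    exact (hx.eq_zero_iff _).2 ((hbd z hz).2 hz0)
  have hd : ∀ i, pderiv i (fun z => x ((e.extend (𝓡∂ (n + 1))).symm z)) y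
      = mfderiv (𝓡∂ (n + 1)) 𝓘(ℝ) x ((e.extend (𝓡∂ (n + 1))).symm y) (coordVector e i y) := by
    intro i
    have h1 := mfderiv_comp_mfderivWithin y (hx.smooth.mdifferentiableAt (by simp))
      ((contMDiffWithinAt_extend_symm_range he hy).mdifferentiableWithinAt (by simp))
      ((𝓡∂ (n + 1)).uniqueMDiffOn y hyr)
    rw [mfderivWithin_eq_fderivWithin] at h1
    exact DFunLike.congr_fun h1 (EuclideanSpace.single i (1 : ℝ) : EuclideanSpace ℝ (Fin (n + 1)))
  -- The tangential derivatives of `X` vanish anyway; if `∂₀X` vanished too, `dx` would kill the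
  -- whole coordinate frame, which spans the tangent space.
  have hdX : pderiv 0 (fun z => x ((e.extend (𝓡∂ (n + 1))).symm z)) y ≠ 0 := by
    intro h0
    have hall : ∀ i, mfderiv (𝓡∂ (n + 1)) 𝓘(ℝ) x ((e.extend (𝓡∂ (n + 1))).symm y)
        (coordVector e i y) = 0 := by
      intro i
      rw [← hd]
      by_cases hi : i = 0
      · rw [hi, h0]
        rfl
      · exact pderiv_eq_zero_of_vanish hi hy0
          ((hXs y hy).contDiffWithinAt.differentiableWithinAt (by simp)) hXb
    refine hx.mfderiv_ne_zero ((e.extend (𝓡∂ (n + 1))).symm y) ((hbd y hy).2 hy0) ?_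
    ext w
    obtain ⟨v, rfl⟩ := coordFrame_surjective he hy w
    rw [coordFrame_apply, map_sum]
    refine Finset.sum_eq_zero fun i _ => ?_
    rw [map_smul, hall, smul_zero]
  refine umbilic_of_einstein (X := fun z => x ((e.extend (𝓡∂ (n + 1))).symm z)) hn hyr hy0
    ?_ ?_ ?_ hXb ?_ hdX ?_
  · filter_upwards [hT] with z hz using smoothMatrixAt_coordMatrix g he hz
  · filter_upwards [hT] with z hz using posDef_coordMatrix g he hz
  · filter_upwards [hT] with z hz using (hXs z hz).contDiffWithinAt
  · filter_upwards [hT] with z hz hz0 h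
    exact hz0.ne' ((hbd z hz).1 ((hx.eq_zero_iff _).1 h))
  · filter_upwards [hT] with z hz hz0
    have h1 : (e.extend (𝓡∂ (n + 1))).symm z ∈ e.source := by
      have := (e.extend (𝓡∂ (n + 1))).map_target hz
      rwa [e.extend_source] at this
    have h2 := hE e he _ h1 ((mem_interior_iff_of_mem_target he hz).2 hz0)
    rw [(e.extend (𝓡∂ (n + 1))).right_inv hz] at h2
    -- The components of `x⁻² g` are definitionally `X⁻²` times those of `g`.
    exact h2

/-- Being Poincaré–Einstein depends on the conformal class only. -/
theorem IsPoincareEinstein.of_isConformal {g g' : SmoothMetric n M}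
    (hg : IsPoincareEinstein g) (h : IsConformal g g') : IsPoincareEinstein g' := by
  obtain ⟨x, hx, hE⟩ := hg
  obtain ⟨u, hu, hgu⟩ := h
  have hexp : ContMDiff (𝓡∂ (n + 1)) 𝓘(ℝ) ∞ fun p => Real.exp (u p) :=
    Real.contDiff_exp.contMDiff.comp hu
  -- With the defining function `eᵘ x` for `g'`, the interior metric is unchanged.
  refine ⟨fun p => Real.exp (u p) * x p, ⟨hexp.mul hx.smooth,
    fun p => mul_nonneg (Real.exp_pos _).le (hx.nonneg p), fun p => ?_, fun p hp h0 => ?_⟩, ?_⟩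
  · rw [mul_eq_zero, or_iff_right (Real.exp_pos _).ne', hx.eq_zero_iff]
  · refine hx.mfderiv_ne_zero p hp ?_
    have h1 : HasMFDerivAt (𝓡∂ (n + 1)) 𝓘(ℝ) (fun p => Real.exp (u p) * x p) p _ :=
      ((hexp.mdifferentiableAt (by simp)).hasMFDerivAt (x := p)).mul
        ((hx.smooth.mdifferentiableAt (by simp)).hasMFDerivAt (x := p))
    have h2 := h1.mfderiv.symm.trans h0
    ext v
    let a : ℝ := mfderiv (𝓡∂ (n + 1)) 𝓘(ℝ) x p v
    let b : ℝ := mfderiv (𝓡∂ (n + 1)) 𝓘(ℝ) (fun p => Real.exp (u p)) p v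
    have h3 : Real.exp (u p) * a + x p * b = 0 := DFunLike.congr_fun h2 v
    -- At the boundary `x = 0`, so `d(eᵘ x) = eᵘ dx` there.
    rw [(hx.eq_zero_iff p).2 hp, zero_mul, add_zero] at h3
    exact (mul_eq_zero.1 h3).resolve_left (Real.exp_pos _).ne'
  · convert hE using 2 with p
    rw [hgu p, smul_smul]
    congr 1
    rw [mul_pow, ← Real.exp_nat_mul, mul_inv, mul_right_comm, Nat.cast_two,
      inv_mul_cancel₀ (Real.exp_pos _).ne', one_mul]

end Main

end PoincareEinstein

theorem corollary4p5 (n : ℕ) (hn : 2 ≤ n) {M : Type*} [TopologicalSpace M] [T2Space M]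
    [CompactSpace M] [ChartedSpace (EuclideanHalfSpace (n + 1)) M]
    [IsManifold (𝓡∂ (n + 1)) ∞ M] (g : PoincareEinstein.SmoothMetric n M)
    (hg : PoincareEinstein.IsPoincareEinstein g) :
    ∀ g' : PoincareEinstein.SmoothMetric n M, PoincareEinstein.IsConformal g g' →
      PoincareEinstein.IsBoundaryTotallyUmbilic g' :=
  fun _ h => (hg.of_isConformal h).isBoundaryTotallyUmbilic hn
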